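/- Let $M\subset\mathbb C^N$ be a compact, smooth, embedded CR-manifold of hypersurface type: a compact smooth submanifold of real dimension $2n-1$, $n\ge 1$, such that $T^{1,0}_x(M)=T^{1,0}_x(\mathbb C^N)\cap(T_xM\otimes\mathbb C)$ has complex dimension $n-1$ for every $x\in M$. Put $T^{0,1}(M)=\overline{T^{1,0}(M)}$, and use the Hermitian metric for which $\partial/\partial z_1,\dots,\partial/\partial z_N$ are orthonormal. Suppose that $M$ is weakly pseudoconvex, and let $\gamma$ be a smooth, purely imaginary, nowhere vanishing global one-form on $M$ that annihilates $T^{1,0}(M)\oplus T^{0,1}(M)$ and whose Levi form is positive semi-definite, that is, $\langle d\gamma_x, L\wedge\bar L\rangle\ge 0$ for all $x\in M$, $L\in T^{1,0}_x(M)$. For a smooth function $\lambda$ near $M$, let $\partial_b\lambda$ (respectively $\bar\partial_b\lambda$) be the one-form on $M$ that equals $d\lambda$ on $T^{1,0}(M)$ (respectively $T^{0,1}(M)$) and vanishes on $T^{0,1}(M)$ (respectively $T^{1,0}(M)$) and on the direction in $TM$ orthogonal to $T^{1,0}(M)\oplus T^{0,1}(M)$. The forms $\partial_b\bar\partial_b\lambda$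 and $\bar\partial_b\partial_b\lambda$ are the $(1,1)$-parts of $d(\bar\partial_b\lambda)$ and $d(\partial_b\lambda)$. Let $q\ge 0$ be an integer, let $A_\lambda\ge 0$, and let $\lambda$ be a smooth real-valued function on an open neighborhood $U$ of $M$ that is plurisubharmonic on $(0,q)$-forms on $U$ with constant $A_\lambda$: at every point of $U$, the sum of any $q$ eigenvalues (counted with multiplicity) of the complex Hessian $\big(\partial^2\lambda/\partial z_j\partial\bar z_k\big)_{j,k=1}^N$ is at least $A_\lambda$. Then $\lambda$ is CR-plurisubharmonic on $(0,q)$-forms on $M$ with the same constant $A_\lambda$: there is a constant $A_0>0$ such that for every $x\in M$ and all orthonormal $Z_1,\dots,Z_q\in T^{1,0}_x(M)$, $$\sum_{j=1}^q\Big\langle \tfrac12\big(\partial_b\bar\partial_b\lambda-\bar\partial_b\partial_b\lambda\big)+A_0\,d\gamma,\; Z_j\wedge\bar Z_j\Big\rangle\ \ge\ A_\lambda .$$ (So $\lambda$ is weakly CR-plurisubharmonic on $(0,q)$-forms, and strictly so if $A_\lambda>0$.) -/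

import Mathlib

open Set Filter Topology
open scoped ContDiff

noncomputable section

namespace CRGeom

/-- Complex Euclidean space `ℂ^N` with its usual Hermitian inner product. -/
abbrev Cn (N : ℕ) : Type := EuclideanSpace ℂ (Fin N)

variable {N : ℕ}

/-- Multiplication by `i` on `ℂ^N` as a real-linear map (the complex structure `J`). -/
def J (N : ℕ) : Cn N →L[ℝ] Cn N :=
  (Complex.I • ContinuousLinearMap.id ℂ (Cn N)).restrictScalars ℝ

/-- `J v = i v`. -/
theorem J_apply (v : Cn N) : J N v = Complex.I • v := rfl

/-! ### The operators `∂` and `∂̄` on functions and the complex Hessian -/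

/-- `∂ f` at `x`, as a complex-valued real-linear form on real vectors:
`∂f(v) = (df(v) - i df(Jv)) / 2`.  In particular `∂f(e_j) = ∂f/∂z_j`. -/
def del (f : Cn N → ℂ) (x : Cn N) : Cn N →L[ℝ] ℂ :=
  (1 / 2 : ℂ) • (fderiv ℝ f x - Complex.I • (fderiv ℝ f x ∘L J N))

/-- `∂̄ f` at `x`: `∂̄f(v) = (df(v) + i df(Jv)) / 2`.
In particular `∂̄f(e_k) = ∂f/∂z̄_k`. -/
def delbar (f : Cn N → ℂ) (x : Cn N) : Cn N →L[ℝ] ℂ :=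
  (1 / 2 : ℂ) • (fderiv ℝ f x + Complex.I • (fderiv ℝ f x ∘L J N))

/-- The complex Hessian `(∂²f/∂z_j∂z̄_k)_{j,k}` at `x`. -/
def complexHessian (f : Cn N → ℂ) (x : Cn N) : Matrix (Fin N) (Fin N) ℂ :=
  fun j k => del (fun y => delbar f y (EuclideanSpace.single k 1)) x (EuclideanSpace.single j 1)

/-- `lam` is plurisubharmonic on `(0,q)`-forms on `U`, with plurisubharmonicity constant `A`:
`lam` is smooth on `U`, `A ≥ 0`, and at every point of `U` the sum of any `q` eigenvalues
(counted with multiplicity) of the complex Hessian is at least `A`.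
(The complex Hessian of a smooth real function on an open set is automatically Hermitian;
the witness only gives access to its real eigenvalues.) -/
def IsPshOnForms (q : ℕ) (lam : Cn N → ℝ) (U : Set (Cn N)) (A : ℝ) : Prop :=
  ContDiffOn ℝ ∞ lam U ∧ 0 ≤ A ∧
    ∀ x ∈ U, ∃ h : (complexHessian (fun y => (lam y : ℂ)) x).IsHermitian,
      ∀ s : Finset (Fin N), s.card = q → A ≤ ∑ i ∈ s, h.eigenvalues i

/-! ### Submanifolds of `ℂ^N` and the induced CR structure -/

/-- `M` is a smooth embedded submanifold of `ℂ^N` of real dimension `d`: locally it is the zero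
set of a smooth map to `ℝ^k`, `k = 2N - d`, with surjective differential. -/
def IsSmoothSubmanifold (M : Set (Cn N)) (d : ℕ) : Prop :=
  ∃ k : ℕ, d + k = 2 * N ∧
    ∀ x ∈ M, ∃ U : Set (Cn N), IsOpen U ∧ x ∈ U ∧
      ∃ ρ : Cn N → EuclideanSpace ℝ (Fin k), ContDiffOn ℝ ∞ ρ U ∧
        (∀ y ∈ U, Function.Surjective (fderiv ℝ ρ y)) ∧
        M ∩ U = {y ∈ U | ρ y = 0}

/-- The real tangent space `T_x M ⊆ ℂ^N`.  For a smooth submanifold the tangent cone is already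
a linear subspace (the kernel of the differential of a local defining map). -/
def tangentSp (M : Set (Cn N)) (x : Cn N) : Submodule ℝ (Cn N) :=
  Submodule.span ℝ (tangentConeAt ℝ M x)

/-- The space `T^{1,0}_x(M) = T^{1,0}_x(ℂ^N) ∩ (T_x M ⊗ ℂ)`, where `ξ ∈ ℂ^N` stands for the vector
`Z_ξ = ∑ ξ_j ∂/∂z_j = (ξ - i Jξ) / 2`.  This vector lies in `T_x M ⊗ ℂ` iff both `ξ` and `Jξ` lie in
`T_x M`.  The identification `ξ ↦ Z_ξ` is complex-linear and it is isometric for the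
Hermitian inner product in which the `∂/∂z_j` are orthonormal. -/
def T10 (M : Set (Cn N)) (x : Cn N) : Submodule ℂ (Cn N) where
  carrier := {ξ | ξ ∈ tangentSp M x ∧ Complex.I • ξ ∈ tangentSp M x}
  add_mem' := by
    rintro a b ⟨ha, ha'⟩ ⟨hb, hb'⟩
    refine ⟨add_mem ha hb, ?_⟩
    rw [smul_add]
    exact add_mem ha' hb'
  zero_mem' := by simp
  smul_mem' := by
    rintro c ξ ⟨h, h'⟩
    have key : ∀ (a b : ℝ), a • ξ + b • (Complex.I • ξ) ∈ tangentSp M x := fun a b =>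
      add_mem (Submodule.smul_mem _ a h) (Submodule.smul_mem _ b h')
    constructor
    · have e : c • ξ = c.re • ξ + c.im • (Complex.I • ξ) := by
        ext i
        simp only [PiLp.smul_apply, PiLp.add_apply, smul_eq_mul, Complex.real_smul]
        conv_lhs => rw [← Complex.re_add_im c]
        ring
      rw [e]
      exact key _ _
    · have e : Complex.I • c • ξ = (-c.im) • ξ + c.re • (Complex.I • ξ) := by
        ext i
        simp only [PiLp.smul_apply, PiLp.add_apply, smul_eq_mul, Complex.real_smul]
        conv_lhs => rw [← Complex.re_add_im c]
        push_cast
        linear_combination (c.im : ℂ) * ξ i * Complex.I_sq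
      rw [e]
      exact key _ _

/-- `M ⊆ ℂ^N` is a smooth CR-manifold of hypersurface type of real dimension `2n - 1`, with the
induced CR structure: `dim_ℂ T^{1,0}_x(M) = n - 1` at every point. -/
def IsCRHypersurfaceType (M : Set (Cn N)) (n : ℕ) : Prop :=
  1 ≤ n ∧ IsSmoothSubmanifold M (2 * n - 1) ∧
    ∀ x ∈ M, Module.finrank ℂ (T10 M x) = n - 1

/-! ### Forms along `M` -/

/-- Complex-valued one-forms along `M`: a form `α` is represented by real-linear functionals
`α x` on `ℂ^N`, of which only the restrictions to `T_x M`, `x ∈ M`, matter.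
Its exterior derivative on `M` is `dα(u,v) = (D_u α)(v) - (D_v α)(u)` for `u, v ∈ T_x M`, where the
derivative is taken along `M`. -/
def extD (M : Set (Cn N)) (α : Cn N → Cn N →L[ℝ] ℂ) (x u v : Cn N) : ℂ :=
  fderivWithin ℝ α M x u v - fderivWithin ℝ α M x v u

/-- The value `⟨Ω, Z_ξ ∧ conj Z_ζ⟩` of (the complex bilinear extension of) a two-form `Ω` on
`Z_ξ = (ξ - i Jξ)/2` and `conj Z_ζ = (ζ + i Jζ)/2`. -/
def pair11 (Ω : Cn N → Cn N → ℂ) (ξ ζ : Cn N) : ℂ :=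
  (1 / 4 : ℂ) * (Ω ξ ζ + Complex.I * Ω ξ (J N ζ) - Complex.I * Ω (J N ξ) ζ
    + Ω (J N ξ) (J N ζ))

/-- The component of type `(1,0) + (0,1)` of a real tangent vector: orthogonal projection onto the
maximal complex subspace of `T_x M` (i.e. along the orthogonal direction `T`).  If `h` is the
image of `v`, the `(1,0)` and `(0,1)` components of `v` are `(h - i Jh)/2` and `(h + i Jh)/2`. -/
def projH (M : Set (Cn N)) (x : Cn N) : Cn N →L[ℝ] Cn N :=
  ((T10 M x).starProjection).restrictScalars ℝ

/-- `∂_b f`: the one-form on `M` equal to `df` on `T^{1,0}(M)` and zero on `T^{0,1}(M)` and on the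
direction `T` orthogonal to `T^{1,0}(M) ⊕ T^{0,1}(M)`. -/
def delb (M : Set (Cn N)) (f : Cn N → ℂ) (x : Cn N) : Cn N →L[ℝ] ℂ :=
  del f x ∘L projH M x

/-- `∂̄_b f`: the one-form on `M` equal to `df` on `T^{0,1}(M)` and zero on `T^{1,0}(M)` and on the
direction `T`. -/
def delbarb (M : Set (Cn N)) (f : Cn N → ℂ) (x : Cn N) : Cn N →L[ℝ] ℂ :=
  delbar f x ∘L projH M x

/-- `⟨∂_b ∂̄_b f, Z_ξ ∧ conj Z_ζ⟩` at `x`: `∂_b` of a `(0,1)`-form is the `(1,1)`-part of its exterior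
derivative on `M`. -/
def delbDelbarb (M : Set (Cn N)) (f : Cn N → ℂ) (x ξ ζ : Cn N) : ℂ :=
  pair11 (extD M (delbarb M f) x) ξ ζ

/-- `⟨∂̄_b ∂_b f, Z_ξ ∧ conj Z_ζ⟩` at `x`: `∂̄_b` of a `(1,0)`-form is the `(1,1)`-part of its exterior
derivative on `M`. -/
def delbarbDelb (M : Set (Cn N)) (f : Cn N → ℂ) (x ξ ζ : Cn N) : ℂ :=
  pair11 (extD M (delb M f) x) ξ ζ

/-- `γ` is a smooth, purely imaginary, global one-form on `M` which annihilates
`T^{1,0}(M) ⊕ T^{0,1}(M)` and satisfies `γ(T) = -1` for a purely imaginary tangent vector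
`T = i t`, `t ∈ T_x M`, at every point (equivalently, `γ` vanishes nowhere). -/
structure IsCharacteristicForm (M : Set (Cn N)) (γ : Cn N → Cn N →L[ℝ] ℂ) : Prop where
  smooth : ContDiffOn ℝ ∞ γ M
  imaginary : ∀ x ∈ M, ∀ v ∈ tangentSp M x, (γ x v).re = 0
  annihilates : ∀ x ∈ M, ∀ v ∈ T10 M x, γ x v = 0
  normalized : ∀ x ∈ M, ∃ t ∈ tangentSp M x, Complex.I * γ x t = -1

/-- The Levi form `⟨dγ_x, Z_ξ ∧ conj Z_ζ⟩`. -/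
def leviForm (M : Set (Cn N)) (γ : Cn N → Cn N →L[ℝ] ℂ) (x ξ ζ : Cn N) : ℂ :=
  pair11 (extD M γ x) ξ ζ

/-- The Levi form given by `γ` is positive semi-definite at every point of `M`; `M` is weakly
pseudoconvex when this holds for some characteristic form `γ`. -/
def LeviNonneg (M : Set (Cn N)) (γ : Cn N → Cn N →L[ℝ] ℂ) : Prop :=
  ∀ x ∈ M, ∀ ξ ∈ T10 M x, 0 ≤ (leviForm M γ x ξ ξ).re

/-! ### CR-plurisubharmonicity -/

/-- There is `A₀ > 0` such that at every `x ∈ M` and for all orthonormal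
`Z_1, …, Z_q ∈ T^{1,0}_x(M)`,
`∑_j ⟨(∂_b ∂̄_b lam - ∂̄_b ∂_b lam)/2 + A₀ dγ, Z_j ∧ conj Z_j⟩ ≥ A`
(the left side is real). -/
def CRPshBound (M : Set (Cn N)) (γ : Cn N → Cn N →L[ℝ] ℂ) (q : ℕ) (lam : Cn N → ℝ)
    (A : ℝ) : Prop :=
  ∃ A₀ : ℝ, 0 < A₀ ∧ ∀ x ∈ M, ∀ Z : Fin q → Cn N, (∀ j, Z j ∈ T10 M x) → Orthonormal ℂ Z →
    A ≤ (∑ j, ((1 / 2 : ℂ) * (delbDelbarb M (fun y => (lam y : ℂ)) x (Z j) (Z j)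
        - delbarbDelb M (fun y => (lam y : ℂ)) x (Z j) (Z j))
      + (A₀ : ℂ) * leviForm M γ x (Z j) (Z j))).re

/-- `lam` is smooth on some open neighbourhood of `M`. -/
def SmoothNear (M : Set (Cn N)) (lam : Cn N → ℝ) : Prop :=
  ∃ U : Set (Cn N), IsOpen U ∧ M ⊆ U ∧ ContDiffOn ℝ ∞ lam U

/-- `lam` is weakly CR-plurisubharmonic on `(0,q)`-forms with constant `A ≥ 0`. -/
def IsWeaklyCRPsh (M : Set (Cn N)) (γ : Cn N → Cn N →L[ℝ] ℂ) (q : ℕ) (lam : Cn N → ℝ)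
    (A : ℝ) : Prop :=
  SmoothNear M lam ∧ 0 ≤ A ∧ CRPshBound M γ q lam A

/-- `lam` is strictly CR-plurisubharmonic on `(0,q)`-forms with constant `A > 0`. -/
def IsStrictlyCRPsh (M : Set (Cn N)) (γ : Cn N → Cn N →L[ℝ] ℂ) (q : ℕ) (lam : Cn N → ℝ)
    (A : ℝ) : Prop :=
  SmoothNear M lam ∧ 0 < A ∧ CRPshBound M γ q lam A

end CRGeom

end

/-! Let `P` be the orthogonal projection onto the complex tangent space `H` of `M`, and let `t` be
the tangent vector orthogonal to `H` with `γ(t) = i`. A form `α ∘ P` has, on `u, v` in `H`, the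
exterior derivative `dα(u,v) + α(w)` with `w = (D_u P)v - (D_v P)u`. This `w` is the bracket at `x`
of the sections `y ↦ P_y u` and `y ↦ P_y v`. It is killed by the differential of a defining map and
by `P`, so `w = c t` with `c` real. Since `γ` annihilates `H`, also `dγ(u,v) = -γ(w) = -c i`: the
correction term is a multiple of the Levi form.

Apply this to `α = ∂̄λ` and `α = ∂λ`. As `∂̄λ - ∂λ = i dλ ∘ J`, on `H` the form `½(∂_b ∂̄_b λ - ∂̄_b
∂_b λ)` is the complex Hessian of `λ` minus `½ dλ(Jt)` times the Levi form
(`half_delbDelbarb_sub_delbarbDelb`). By compactness `½ dλ(Jt)` is bounded above by some `A₀ > 0`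
(`exists_bound_half_fderiv_J`), and the Levi form is nonnegative, so adding `A₀ dγ` leaves at least
the Hessian. Ky Fan's inequality (`le_sum_re_inner_of_le_sum_eigenvalues`) bounds its partial traces
from below.

The analytic input is that `P` is differentiable along `M` (`differentiableWithinAt_projH`), which
follows from the constant dimension of `H`. -/

noncomputable section

namespace CRGeom

/-! ### Ky Fan's inequality for partial traces -/

/-- A weighted sum with weights in `[0, 1]` of total mass `q` dominates any lower bound for
the sums over `q`-element subsets. -/
theorem le_sum_mul_of_le_sum_card_eq {ι : Type*} [Fintype ι] (l c : ι → ℝ) (q : ℕ) (A : ℝ)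
    (hA : ∀ s : Finset ι, s.card = q → A ≤ ∑ i ∈ s, l i)
    (h0 : ∀ i, 0 ≤ c i) (h1 : ∀ i, c i ≤ 1) (hc : ∑ i, c i = q) :
    A ≤ ∑ i, l i * c i := by
  classical
  have hq : q ≤ Fintype.card ι := by
    have : ∑ i, c i ≤ ∑ _i : ι, (1 : ℝ) := Finset.sum_le_sum fun i _ => h1 i
    rw [hc] at this
    simpa using this
  have hne : (Finset.powersetCard q (Finset.univ : Finset ι)).Nonempty :=
    Finset.powersetCard_nonempty.2 (by simpa using hq)
  obtain ⟨s, hs, hmin⟩ := Finset.exists_min_image _ (fun s => ∑ i ∈ s, l i) hne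
  have hcard : s.card = q := (Finset.mem_powersetCard.1 hs).2
  have hexch : ∀ i ∈ s, ∀ j ∉ s, l i ≤ l j := by
    intro i hi j hj
    have hj' : j ∉ s.erase i := fun h => hj (Finset.mem_of_mem_erase h)
    have h := hmin (insert j (s.erase i)) (by
      rw [Finset.mem_powersetCard]
      refine ⟨Finset.subset_univ _, ?_⟩
      rw [Finset.card_insert_of_notMem hj', Finset.card_erase_of_mem hi, hcard]
      have : 0 < s.card := Finset.card_pos.2 ⟨i, hi⟩
      omega)
    rw [Finset.sum_insert hj', ← Finset.add_sum_erase s l hi] at h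
    linarith
  -- A threshold separating the values on the minimizing set `s` from the values off it; it exists
  -- by the exchange inequality.
  obtain ⟨μ, hμs, hμc⟩ : ∃ μ : ℝ, (∀ i ∈ s, l i ≤ μ) ∧ ∀ j ∉ s, μ ≤ l j := by
    rcases s.eq_empty_or_nonempty with rfl | hsne
    · rcases isEmpty_or_nonempty ι with hι | hι
      · exact ⟨0, by simp, fun j => hι.elim j⟩
      · obtain ⟨j, -, hj⟩ := Finset.exists_min_image Finset.univ l Finset.univ_nonempty
        exact ⟨l j, by simp, fun k _ => hj k (Finset.mem_univ k)⟩
    · obtain ⟨i, hi, him⟩ := Finset.exists_max_image s l hsne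
      exact ⟨l i, him, fun j hj => hexch i hi j hj⟩
  refine (hA s hcard).trans ?_
  -- Moving mass into or out of `s` costs at least `μ` per unit. After summation the `μ` terms
  -- cancel, because `c` and the indicator of `s` both have total mass `q`.
  have hterm : ∀ i, (if i ∈ s then l i else 0) + μ * (c i - if i ∈ s then 1 else 0)
      ≤ l i * c i := by
    intro i
    by_cases hi : i ∈ s
    · simp only [hi, if_true]
      nlinarith [hμs i hi, h1 i]
    · simp only [hi, if_false]
      nlinarith [hμc i hi, h0 i]
  have hsum := Finset.sum_le_sum fun i (_ : i ∈ Finset.univ) => hterm i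
  rw [Finset.sum_add_distrib, ← Finset.mul_sum, Finset.sum_sub_distrib, hc] at hsum
  simpa [hcard] using hsum

/-- The quadratic form of a Hermitian matrix in its eigenvector basis. -/
theorem re_inner_toEuclideanLin_eq_sum {N : ℕ} {H : Matrix (Fin N) (Fin N) ℂ}
    (hH : H.IsHermitian) (w : EuclideanSpace ℂ (Fin N)) :
    (inner ℂ w (Matrix.toEuclideanLin H w)).re
      = ∑ i, hH.eigenvalues i * ‖inner ℂ (hH.eigenvectorBasis i) w‖ ^ 2 := by
  rw [← hH.eigenvectorBasis.sum_inner_mul_inner w (Matrix.toEuclideanLin H w), Complex.re_sum]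
  refine Finset.sum_congr rfl fun i _ => ?_
  have hT : Matrix.toEuclideanLin H (hH.eigenvectorBasis i)
      = (hH.eigenvalues i : ℂ) • hH.eigenvectorBasis i := by
    ext k
    have := congrFun (hH.mulVec_eigenvectorBasis i) k
    simpa [Matrix.toLpLin_apply] using this
  have hsymm := Matrix.isSymmetric_toEuclideanLin_iff.2 hH
  rw [← hsymm (hH.eigenvectorBasis i) w, hT, inner_smul_left, Complex.conj_ofReal,
    mul_left_comm, ← inner_conj_symm, Complex.conj_mul']
  norm_cast

/-- Ky Fan: a lower bound for sums of `q` eigenvalues bounds the partial traces of rank `q`. -/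
theorem le_sum_re_inner_of_le_sum_eigenvalues {N q : ℕ} {H : Matrix (Fin N) (Fin N) ℂ}
    (hH : H.IsHermitian) {A : ℝ}
    (hA : ∀ s : Finset (Fin N), s.card = q → A ≤ ∑ i ∈ s, hH.eigenvalues i)
    (w : Fin q → EuclideanSpace ℂ (Fin N)) (hw : Orthonormal ℂ w) :
    A ≤ ∑ j, (inner ℂ (w j) (Matrix.toEuclideanLin H (w j))).re := by
  -- The weight of an eigenvector is the squared length of its projection to the span of `w`: at
  -- most `1` by Bessel, with total `q` by Parseval.
  have h := le_sum_mul_of_le_sum_card_eq hH.eigenvalues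
    (fun i => ∑ j, ‖inner ℂ (hH.eigenvectorBasis i) (w j)‖ ^ 2) q A hA
    (fun i => by positivity)
    (fun i => by
      have := hw.sum_inner_products_le (s := Finset.univ) (hH.eigenvectorBasis i)
      rw [hH.eigenvectorBasis.norm_eq_one, one_pow] at this
      simpa only [norm_inner_symm] using this)
    (by
      rw [Finset.sum_comm]
      simp [hH.eigenvectorBasis.sum_sq_norm_inner_right, hw.norm_eq_one])
  refine h.trans_eq ?_
  simp_rw [re_inner_toEuclideanLin_eq_sum hH, Finset.mul_sum]
  exact Finset.sum_comm

/-! ### Differentiability of orthogonal projections onto kernels -/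

theorem differentiableWithinAt_clm_comp {G₁ G₂ G₃ X : Type*}
    [NormedAddCommGroup G₁] [NormedSpace ℂ G₁] [NormedAddCommGroup G₂] [NormedSpace ℂ G₂]
    [NormedAddCommGroup G₃] [NormedSpace ℂ G₃] [NormedAddCommGroup X] [NormedSpace ℝ X]
    {s : Set X} {x : X} {a : X → G₂ →L[ℂ] G₃} {b : X → G₁ →L[ℂ] G₂}
    (ha : DifferentiableWithinAt ℝ a s x) (hb : DifferentiableWithinAt ℝ b s x) :
    DifferentiableWithinAt ℝ (fun y => a y ∘L b y) s x := by
  have hbil : IsBoundedBilinearMap ℝ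
      (fun p : (G₂ →L[ℂ] G₃) × (G₁ →L[ℂ] G₂) => p.1 ∘L p.2) :=
    { add_left := fun S T U => ContinuousLinearMap.add_comp S T U
      smul_left := fun c S T => ContinuousLinearMap.smul_comp c S T
      add_right := fun S T U => ContinuousLinearMap.comp_add S T U
      smul_right := fun c S T => by ext; simp
      bound := ⟨1, one_pos, fun S T => by
        simpa using ContinuousLinearMap.opNorm_comp_le S T⟩ }
  exact (hbil.differentiableAt (a x, b x)).comp_differentiableWithinAt x (ha.prodMk hb)

section Projection

variable {E F X : Type*} [NormedAddCommGroup E] [InnerProductSpace ℂ E] [CompleteSpace E]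
  [NormedAddCommGroup F] [InnerProductSpace ℂ F] [CompleteSpace F]
  [NormedAddCommGroup X] [NormedSpace ℝ X]

/-- Taking adjoints, as a real-linear map. -/
def realAdjoint : (E →L[ℂ] F) →L[ℝ] (F →L[ℂ] E) :=
  LinearMap.mkContinuous
    { toFun := fun T => ContinuousLinearMap.adjoint T
      map_add' := fun S T => map_add _ S T
      map_smul' := fun r T => by
        have : r • T = (r : ℂ) • T := by ext; simp
        rw [this, map_smulₛₗ]
        ext; simp } 1 (fun T => by simp)

theorem injective_adjoint_of_surjective {K : E →L[ℂ] F} (hK : Function.Surjective K) :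
    Function.Injective (ContinuousLinearMap.adjoint K) := by
  rw [injective_iff_map_eq_zero]
  intro a ha
  obtain ⟨b, rfl⟩ := hK a
  have : inner ℂ (K b) (K b) = (0 : ℂ) := by
    rw [← ContinuousLinearMap.adjoint_inner_right, ha, inner_zero_right]
  exact inner_self_eq_zero.1 this

theorem isUnit_comp_adjoint_iff_surjective [FiniteDimensional ℂ F] (K : E →L[ℂ] F) :
    IsUnit (K ∘L ContinuousLinearMap.adjoint K) ↔ Function.Surjective K := by
  rw [ContinuousLinearMap.isUnit_iff_bijective]
  constructor
  · intro h y
    obtain ⟨a, ha⟩ := h.2 y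
    exact ⟨_, ha⟩
  · intro hK
    have hinj : Function.Injective (K ∘L ContinuousLinearMap.adjoint K) := by
      rw [injective_iff_map_eq_zero]
      intro a ha
      have h0 : ContinuousLinearMap.adjoint K a = 0 := by
        rw [← inner_self_eq_zero (𝕜 := ℂ), ContinuousLinearMap.adjoint_inner_left]
        simp only [ContinuousLinearMap.comp_apply] at ha
        rw [ha, inner_zero_right]
      exact injective_adjoint_of_surjective hK (by simpa using h0)
    exact ⟨hinj, (LinearMap.injective_iff_surjective
      (f := ((K ∘L ContinuousLinearMap.adjoint K : F →L[ℂ] F) : F →ₗ[ℂ] F))).1 hinj⟩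

/-- The orthogonal projection onto the kernel of a surjective map `K` is
`1 - K* (K K*)⁻¹ K`. -/
theorem starProjection_ker_eq [FiniteDimensional ℂ E] [FiniteDimensional ℂ F] (K : E →L[ℂ] F)
    (hK : Function.Surjective K) :
    (LinearMap.ker (K : E →ₗ[ℂ] F)).starProjection = ContinuousLinearMap.id ℂ E -
      ContinuousLinearMap.adjoint K ∘L
        (Ring.inverse (K ∘L ContinuousLinearMap.adjoint K : F →L[ℂ] F) ∘L K) := by
  ext v
  have hu := (isUnit_comp_adjoint_iff_surjective K).2 hK
  apply Submodule.eq_starProjection_of_mem_of_inner_eq_zero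
  · have h := Ring.mul_inverse_cancel _ hu
    have h' : K (ContinuousLinearMap.adjoint K
        (Ring.inverse (K ∘L ContinuousLinearMap.adjoint K) (K v))) = K v :=
      DFunLike.congr_fun h (K v)
    simp [LinearMap.mem_ker, h']
  · intro w hw
    have hw' : K w = 0 := hw
    simp [ContinuousLinearMap.adjoint_inner_left, hw']

/-- Surjectivity of `K` amounts to invertibility of `K K*`, an open condition, and every operation
in `1 - K* (K K*)⁻¹ K` is real-differentiable. -/
theorem differentiableWithinAt_starProjection_ker_of_surjective [FiniteDimensional ℂ E]
    [FiniteDimensional ℂ F] {K : X → E →L[ℂ] F} {s : Set X} {x : X}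
    (hd : DifferentiableWithinAt ℝ K s x) (hK : Function.Surjective (K x)) :
    (∀ᶠ y in 𝓝[s] x, Function.Surjective (K y)) ∧
    DifferentiableWithinAt ℝ
      (fun y => (LinearMap.ker (K y : E →ₗ[ℂ] F)).starProjection) s x := by
  have hadj : DifferentiableWithinAt ℝ (fun y => ContinuousLinearMap.adjoint (K y)) s x :=
    (realAdjoint (E := E) (F := F)).differentiableAt.comp_differentiableWithinAt x hd
  have hKK := differentiableWithinAt_clm_comp hd hadj
  have hu := (isUnit_comp_adjoint_iff_surjective (K x)).2 hK
  have hev : ∀ᶠ y in 𝓝[s] x, Function.Surjective (K y) := by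
    have := hKK.continuousWithinAt.eventually (hu.unit.nhds)
    filter_upwards [this] with y hy
    exact (isUnit_comp_adjoint_iff_surjective (K y)).1 hy
  refine ⟨hev, ?_⟩
  have hinv := DifferentiableWithinAt.inverse (R := F →L[ℂ] F) hKK hu
  have hfin := (differentiableWithinAt_const (ContinuousLinearMap.id ℂ E)).sub
    (differentiableWithinAt_clm_comp hadj (differentiableWithinAt_clm_comp hinv hd))
  refine hfin.congr_of_eventuallyEq ?_ (starProjection_ker_eq (K x) hK)
  filter_upwards [hev] with y hy
  exact starProjection_ker_eq (K y) hy

/-- The orthogonal projection onto the kernel of a differentiable family of linear maps of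
constant rank is differentiable. -/
theorem differentiableWithinAt_starProjection_ker [FiniteDimensional ℂ E]
    [FiniteDimensional ℂ F] {K : X → E →L[ℂ] F} {s : Set X} {x : X}
    (hd : DifferentiableWithinAt ℝ K s x)
    (hrank : ∀ᶠ y in 𝓝[s] x, Module.finrank ℂ (LinearMap.ker (K y : E →ₗ[ℂ] F))
      = Module.finrank ℂ (LinearMap.ker (K x : E →ₗ[ℂ] F))) :
    DifferentiableWithinAt ℝ
      (fun y => (LinearMap.ker (K y : E →ₗ[ℂ] F)).starProjection) s x := by
  -- Projecting to the range of `K x` makes the map surjective at `x`, hence nearby. There the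
  -- kernel can only grow, and constancy of its dimension rules that out.
  set W := LinearMap.range (K x : E →ₗ[ℂ] F) with hW
  let R : F →L[ℂ] W := W.orthogonalProjectionOnto
  have hRK : Function.Surjective (R ∘L K x) := by
    rintro ⟨_, v, rfl⟩
    exact ⟨v, Submodule.orthogonalProjectionOnto_mem_subspace_eq_self (K := W) ⟨_, v, rfl⟩⟩
  have hd' : DifferentiableWithinAt ℝ (fun y => R ∘L K y) s x :=
    differentiableWithinAt_clm_comp (differentiableWithinAt_const R) hd
  obtain ⟨hs, hdiff⟩ := differentiableWithinAt_starProjection_ker_of_surjective hd' hRK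
  have hle : ∀ y, LinearMap.ker (K y : E →ₗ[ℂ] F)
      ≤ LinearMap.ker ((R ∘L K y : E →L[ℂ] W) : E →ₗ[ℂ] W) := by
    intro y v hv
    have hv' : K y v = 0 := hv
    simp [LinearMap.mem_ker, hv']
  have hdim : ∀ y, Function.Surjective (R ∘L K y) → Module.finrank ℂ W + Module.finrank ℂ
      (LinearMap.ker ((R ∘L K y : E →L[ℂ] W) : E →ₗ[ℂ] W)) = Module.finrank ℂ E := by
    intro y hy
    rw [← LinearMap.finrank_range_add_finrank_ker ((R ∘L K y : E →L[ℂ] W) : E →ₗ[ℂ] W),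
      LinearMap.range_eq_top.2 hy, finrank_top]
  have hx' := LinearMap.finrank_range_add_finrank_ker (K x : E →ₗ[ℂ] F)
  rw [← hW] at hx'
  have heq : ∀ y, Function.Surjective (R ∘L K y) →
      Module.finrank ℂ (LinearMap.ker (K y : E →ₗ[ℂ] F))
        = Module.finrank ℂ (LinearMap.ker (K x : E →ₗ[ℂ] F)) →
      LinearMap.ker (K y : E →ₗ[ℂ] F)
        = LinearMap.ker ((R ∘L K y : E →L[ℂ] W) : E →ₗ[ℂ] W) := by
    intro y hy hr
    refine Submodule.eq_of_le_of_finrank_le (hle y) ?_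
    have := hdim y hy
    omega
  refine hdiff.congr_of_eventuallyEq ?_ ?_
  · filter_upwards [hs, hrank] with y h1 h2
    simp only [heq y h1 h2]
  · simp only [heq x hRK rfl]

end Projection

/-! ### Local defining maps and the complex tangent space -/

variable {N : ℕ}

/-- The complex-linear map `v ↦ L v - i L (i v)` attached to a real-linear map `L`. -/
def holPart (k : ℕ) : (Cn N →L[ℝ] EuclideanSpace ℝ (Fin k)) →ₗ[ℝ]
    (Cn N →L[ℂ] EuclideanSpace ℂ (Fin k)) where
  toFun L := LinearMap.toContinuousLinearMap
    { toFun := fun v => WithLp.toLp 2 fun j => (L v j : ℂ) - Complex.I * (L (Complex.I • v) j : ℂ)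
      map_add' := fun v w => by
        ext j
        simp only [smul_add, map_add, PiLp.add_apply, Complex.ofReal_add]
        ring
      map_smul' := fun c v => by
        have h1 : c • v = c.re • v + c.im • (Complex.I • v) := by
          ext i
          simp only [PiLp.smul_apply, PiLp.add_apply, smul_eq_mul, Complex.real_smul]
          conv_lhs => rw [← Complex.re_add_im c]
          ring
        have h2 : Complex.I • c • v = (-c.im) • v + c.re • (Complex.I • v) := by
          ext i
          simp only [PiLp.smul_apply, PiLp.add_apply, smul_eq_mul, Complex.real_smul]
          conv_lhs => rw [← Complex.re_add_im c]
          push_cast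
          linear_combination (c.im : ℂ) * v i * Complex.I_sq
        ext j
        rw [h2, h1]
        simp only [map_add, map_smul, PiLp.add_apply, PiLp.smul_apply, smul_eq_mul,
          Complex.ofReal_add, Complex.ofReal_mul, Complex.ofReal_neg, RingHom.id_apply]
        conv_rhs => rw [← Complex.re_add_im c]
        linear_combination ((c.im : ℂ) * (L (Complex.I • v) j : ℂ)) * Complex.I_sq }
  map_add' L L' := by
    ext v j
    simp only [LinearMap.coe_toContinuousLinearMap', LinearMap.coe_mk, AddHom.coe_mk,
      add_apply, PiLp.add_apply, Complex.ofReal_add]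
    ring
  map_smul' r L := by
    ext v j
    simp only [LinearMap.coe_toContinuousLinearMap', LinearMap.coe_mk, AddHom.coe_mk,
      smul_apply, PiLp.smul_apply, smul_eq_mul, Complex.ofReal_mul,
      RingHom.id_apply, Complex.real_smul]
    ring

theorem holPart_apply {k : ℕ} (L : Cn N →L[ℝ] EuclideanSpace ℝ (Fin k)) (v : Cn N) (j : Fin k) :
    holPart k L v j = (L v j : ℂ) - Complex.I * (L (Complex.I • v) j : ℂ) := rfl

theorem holPart_eq_zero_iff {k : ℕ} (L : Cn N →L[ℝ] EuclideanSpace ℝ (Fin k)) (v : Cn N) :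
    holPart k L v = 0 ↔ L v = 0 ∧ L (Complex.I • v) = 0 := by
  have key : ∀ j, holPart k L v j = 0 ↔ L v j = 0 ∧ L (Complex.I • v) j = 0 := by
    intro j
    rw [holPart_apply, Complex.ext_iff]
    simp
  constructor
  · intro h
    have h' := fun j => (key j).1 (by rw [h]; rfl)
    exact ⟨PiLp.ext fun j => (h' j).1, PiLp.ext fun j => (h' j).2⟩
  · rintro ⟨h1, h2⟩
    exact PiLp.ext fun j => (key j).2 ⟨by rw [h1]; rfl, by rw [h2]; rfl⟩

/-- Derivatives within `M` need not be unique on all of `ℂ^N`, but they are on the span of the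
tangent cone. This makes `fderivWithin` along `M` usable in tangent directions. -/
theorem eqOn_tangentSp_of_hasFDerivWithinAt {F : Type*} [NormedAddCommGroup F] [NormedSpace ℝ F]
    {M : Set (Cn N)} {x : Cn N} {g : Cn N → F} {g₁ g₂ : Cn N →L[ℝ] F}
    (h₁ : HasFDerivWithinAt g g₁ M x) (h₂ : HasFDerivWithinAt g g₂ M x)
    {u : Cn N} (hu : u ∈ tangentSp M x) : g₁ u = g₂ u := by
  have hle : tangentSp M x ≤ LinearMap.eqLocus (g₁ : Cn N →ₗ[ℝ] F) (g₂ : Cn N →ₗ[ℝ] F) :=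
    Submodule.span_le.2 fun v hv => h₁.unique_on h₂ hv
  exact hle hu

theorem mem_tangentSp_of_mem_T10 {M : Set (Cn N)} {x v : Cn N} (hv : v ∈ T10 M x) :
    v ∈ tangentSp M x := hv.1

theorem J_mem_T10 {M : Set (Cn N)} {x v : Cn N} (hv : v ∈ T10 M x) : J N v ∈ T10 M x := by
  rw [J_apply]
  exact Submodule.smul_mem _ _ hv

theorem projH_mem (M : Set (Cn N)) (x v : Cn N) : projH M x v ∈ T10 M x :=
  Submodule.starProjection_apply_mem _ v

theorem projH_eq_self {M : Set (Cn N)} {x v : Cn N} (hv : v ∈ T10 M x) : projH M x v = v :=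
  (Submodule.starProjection_eq_self_iff (K := T10 M x)).2 hv

theorem projH_comp_projH (M : Set (Cn N)) (x : Cn N) : projH M x ∘L projH M x = projH M x := by
  ext1 v
  exact projH_eq_self (projH_mem M x v)

/-- Near a point of `M` there is a smooth map, vanishing on `M`, whose differential annihilates the
tangent spaces, has kernel of dimension `2n - 1`, and determines `T^{1,0}(M)`. -/
theorem exists_local_defining {M : Set (Cn N)} {n : ℕ} (hM : IsCRHypersurfaceType M n)
    {x : Cn N} (hx : x ∈ M) :
    ∃ (k : ℕ) (U : Set (Cn N)) (ρ : Cn N → EuclideanSpace ℝ (Fin k)), IsOpen U ∧ x ∈ U ∧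
      ContDiffOn ℝ ∞ ρ U ∧ ∀ y ∈ M, y ∈ U →
        (∀ v ∈ tangentSp M y, fderiv ℝ ρ y v = 0) ∧
        Module.finrank ℝ (LinearMap.ker (fderiv ℝ ρ y : Cn N →ₗ[ℝ] EuclideanSpace ℝ (Fin k)))
          = 2 * n - 1 ∧
        T10 M y = LinearMap.ker
          (holPart k (fderiv ℝ ρ y) : Cn N →ₗ[ℂ] EuclideanSpace ℂ (Fin k)) := by
  obtain ⟨hn, ⟨k, hk, hloc⟩, hdim⟩ := hM
  obtain ⟨U, hU, hxU, ρ, hρ, hsurj, hMU⟩ := hloc x hx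
  refine ⟨k, U, ρ, hU, hxU, hρ, fun y hy hyU => ?_⟩
  have htan : ∀ v ∈ tangentSp M y, fderiv ℝ ρ y v = 0 := by
    intro v hv
    have hd : HasFDerivWithinAt ρ (fderiv ℝ ρ y) M y :=
      ((hρ.contDiffAt (hU.mem_nhds hyU)).differentiableAt (by simp)).hasFDerivAt.hasFDerivWithinAt
    have h0 : HasFDerivWithinAt ρ (0 : Cn N →L[ℝ] EuclideanSpace ℝ (Fin k)) M y := by
      have hzero : ∀ z ∈ M, z ∈ U → ρ z = 0 := fun z hz hzU => by
        have : z ∈ M ∩ U := ⟨hz, hzU⟩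
        rw [hMU] at this
        exact this.2
      refine (hasFDerivWithinAt_const (0 : EuclideanSpace ℝ (Fin k)) y M).congr_of_eventuallyEq
        ?_ (hzero y hy hyU)
      filter_upwards [self_mem_nhdsWithin, mem_nhdsWithin_of_mem_nhds (hU.mem_nhds hyU)]
        with z hz hzU using hzero z hz hzU
    exact eqOn_tangentSp_of_hasFDerivWithinAt hd h0 hv
  have hker : Module.finrank ℝ
      (LinearMap.ker (fderiv ℝ ρ y : Cn N →ₗ[ℝ] EuclideanSpace ℝ (Fin k))) = 2 * n - 1 := by
    have h := LinearMap.finrank_range_add_finrank_ker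
      (fderiv ℝ ρ y : Cn N →ₗ[ℝ] EuclideanSpace ℝ (Fin k))
    rw [LinearMap.range_eq_top.2 (hsurj y hyU), finrank_top, finrank_real_of_complex,
      finrank_euclideanSpace_fin, finrank_euclideanSpace_fin] at h
    omega
  refine ⟨htan, hker, ?_⟩
  refine Submodule.eq_of_le_of_finrank_le ?_ ?_
  · intro v hv
    exact (holPart_eq_zero_iff _ v).2 ⟨htan _ hv.1, htan _ hv.2⟩
  · set H := LinearMap.ker
      (holPart k (fderiv ℝ ρ y) : Cn N →ₗ[ℂ] EuclideanSpace ℂ (Fin k)) with hH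
    -- Parity: a complex subspace inside a real space of dimension `2n - 1` has complex dimension at
    -- most `n - 1`, which is that of `T10`. So it need not be known that `tangentSp` fills the
    -- kernel of the differential.
    have h1 : Module.finrank ℝ (H.restrictScalars ℝ) ≤ 2 * n - 1 := by
      rw [← hker]
      apply Submodule.finrank_mono
      intro v hv
      exact ((holPart_eq_zero_iff _ v).1 hv).1
    have h2 : Module.finrank ℝ (H.restrictScalars ℝ) = 2 * Module.finrank ℂ H :=
      finrank_real_of_complex H
    rw [hdim y hy]
    omega

/-- `T10` is locally the kernel of a smooth family of complex-linear maps, of constant dimension `n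
- 1`. -/
theorem differentiableWithinAt_projH {M : Set (Cn N)} {n : ℕ} (hM : IsCRHypersurfaceType M n)
    {x : Cn N} (hx : x ∈ M) : DifferentiableWithinAt ℝ (projH M) M x := by
  obtain ⟨k, U, ρ, hU, hxU, hρ, h⟩ := exists_local_defining hM hx
  have hfd : DifferentiableWithinAt ℝ (fun y => holPart k (fderiv ℝ ρ y)) M x := by
    have h1 : DifferentiableAt ℝ (fderiv ℝ ρ) x :=
      ((hρ.contDiffAt (hU.mem_nhds hxU)).fderiv_right (m := 1) (by norm_cast)).differentiableAt
        (by simp)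
    exact (LinearMap.toContinuousLinearMap (holPart (N := N) k)).differentiableAt.comp_differentiableWithinAt
      x h1.differentiableWithinAt
  have hmem : ∀ᶠ y in 𝓝[M] x, y ∈ M ∧ y ∈ U := by
    filter_upwards [self_mem_nhdsWithin, mem_nhdsWithin_of_mem_nhds (hU.mem_nhds hxU)]
      with y h1 h2 using ⟨h1, h2⟩
  have hproj := differentiableWithinAt_starProjection_ker hfd (by
    filter_upwards [hmem] with y hy
    rw [← (h y hy.1 hy.2).2.2, ← (h x hx hxU).2.2, hM.2.2 y hy.1, hM.2.2 x hx])
  have hres : DifferentiableWithinAt ℝ (fun y => ((LinearMap.ker (holPart k (fderiv ℝ ρ y) :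
      Cn N →ₗ[ℂ] EuclideanSpace ℂ (Fin k))).starProjection).restrictScalars ℝ) M x :=
    (ContinuousLinearMap.restrictScalarsL ℂ (Cn N) (Cn N) ℝ
      ℝ).differentiableAt.comp_differentiableWithinAt x hproj
  refine hres.congr_of_eventuallyEq ?_ ?_
  · filter_upwards [hmem] with y hy
    simp only [projH, (h y hy.1 hy.2).2.2]
  · simp only [projH, (h x hx hxU).2.2]

/-! ### Derivatives of the projection and brackets of complex tangent fields -/

theorem fderivWithin_comp_projH {F : Type*} [NormedAddCommGroup F] [NormedSpace ℝ F]
    {M : Set (Cn N)} {x : Cn N} (hP : DifferentiableWithinAt ℝ (projH M) M x)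
    {α : Cn N → Cn N →L[ℝ] F} (hα : DifferentiableWithinAt ℝ α M x) {u v : Cn N}
    (hu : u ∈ tangentSp M x) (hv : v ∈ T10 M x) :
    fderivWithin ℝ (fun y => α y ∘L projH M y) M x u v
      = fderivWithin ℝ α M x u v + α x (fderivWithin ℝ (projH M) M x u v) := by
  have h := hα.hasFDerivWithinAt.clm_comp hP.hasFDerivWithinAt
  rw [eqOn_tangentSp_of_hasFDerivWithinAt h.differentiableWithinAt.hasFDerivWithinAt h hu]
  simp [projH_eq_self hv, add_comm]

/-- Product rule applied to `α ∘ P = 0`. It serves both for `γ` and for the differential of a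
defining map. -/
theorem fderivWithin_apply_of_comp_projH_eq_zero {F : Type*} [NormedAddCommGroup F]
    [NormedSpace ℝ F] {M : Set (Cn N)} {x : Cn N} (hx : x ∈ M)
    (hP : DifferentiableWithinAt ℝ (projH M) M x)
    {α : Cn N → Cn N →L[ℝ] F} (hα : DifferentiableWithinAt ℝ α M x)
    (h0 : ∀ᶠ y in 𝓝[M] x, ∀ v ∈ T10 M y, α y v = 0) {u v : Cn N}
    (hu : u ∈ tangentSp M x) (hv : v ∈ T10 M x) :
    fderivWithin ℝ α M x u v = - α x (fderivWithin ℝ (projH M) M x u v) := by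
  have h := fderivWithin_comp_projH hP hα hu hv
  have he : (fun y => α y ∘L projH M y) =ᶠ[𝓝[M] x] fun _ => 0 := by
    filter_upwards [h0] with y hy
    ext w
    exact hy _ (projH_mem M y w)
  rw [he.fderivWithin_eq (he.self_of_nhdsWithin hx), fderivWithin_const_apply] at h
  exact eq_neg_of_add_eq_zero_left h.symm

/-- Differentiate `P ∘ P = P` and evaluate at `v = P v`. -/
theorem projH_fderivWithin_projH {M : Set (Cn N)} {x : Cn N}
    (hP : DifferentiableWithinAt ℝ (projH M) M x) {u v : Cn N}
    (hu : u ∈ tangentSp M x) (hv : v ∈ T10 M x) :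
    projH M x (fderivWithin ℝ (projH M) M x u v) = 0 := by
  have h := fderivWithin_comp_projH hP hP hu hv
  simp only [projH_comp_projH] at h
  simpa using h

/-- The bracket of sections of the complex tangent bundle is tangent to `M`. -/
theorem fderiv_defining_bracket {M : Set (Cn N)} {x : Cn N} (hx : x ∈ M)
    (hP : DifferentiableWithinAt ℝ (projH M) M x) {k : ℕ} {U : Set (Cn N)}
    {ρ : Cn N → EuclideanSpace ℝ (Fin k)} (hU : IsOpen U) (hxU : x ∈ U) (hρ : ContDiffOn ℝ ∞ ρ U)
    (htan : ∀ y ∈ M, y ∈ U → ∀ v ∈ tangentSp M y, fderiv ℝ ρ y v = 0) {u v : Cn N}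
    (hu : u ∈ T10 M x) (hv : v ∈ T10 M x) :
    fderiv ℝ ρ x (fderivWithin ℝ (projH M) M x u v - fderivWithin ℝ (projH M) M x v u) = 0 := by
  have hc := hρ.contDiffAt (hU.mem_nhds hxU)
  have hd : DifferentiableAt ℝ (fderiv ℝ ρ) x :=
    (hc.fderiv_right (m := 1) (by norm_cast)).differentiableAt (by simp)
  have hsymm : IsSymmSndFDerivAt ℝ ρ x := hc.isSymmSndFDerivAt (by simpa using ENat.LEInfty.out)
  have hev : ∀ᶠ y in 𝓝[M] x, ∀ v ∈ T10 M y, fderiv ℝ ρ y v = 0 := by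
    filter_upwards [self_mem_nhdsWithin, mem_nhdsWithin_of_mem_nhds (hU.mem_nhds hxU)]
      with y h1 h2 v hv using htan y h1 h2 v hv.1
  -- The second derivative of `ρ` is symmetric, so exchanging `a` and `b` gives the claim.
  have key : ∀ {a b : Cn N}, a ∈ T10 M x → b ∈ T10 M x → fderiv ℝ (fderiv ℝ ρ) x a b
      = - fderiv ℝ ρ x (fderivWithin ℝ (projH M) M x a b) := by
    intro a b ha hb
    rw [← fderivWithin_apply_of_comp_projH_eq_zero hx hP hd.differentiableWithinAt hev ha.1 hb,
      eqOn_tangentSp_of_hasFDerivWithinAt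
        hd.differentiableWithinAt.hasFDerivWithinAt hd.hasFDerivAt.hasFDerivWithinAt ha.1]
  have h1 := key hu hv
  rw [hsymm.eq u v, key hv hu] at h1
  rw [map_sub, ← neg_inj.1 h1, sub_self]

/-- The complex tangent space and one transverse vector `t` fill the kernel of the differential
of a defining map. -/
theorem eq_smul_of_projH_eq_zero {M : Set (Cn N)} {x : Cn N} {n : ℕ}
    (hM : IsCRHypersurfaceType M n) (hx : x ∈ M) {k : ℕ}
    {L : Cn N →L[ℝ] EuclideanSpace ℝ (Fin k)} (htan : ∀ v ∈ tangentSp M x, L v = 0)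
    (hker : Module.finrank ℝ (LinearMap.ker (L : Cn N →ₗ[ℝ] EuclideanSpace ℝ (Fin k)))
      = 2 * n - 1)
    {t : Cn N} (ht : t ∈ tangentSp M x) (htH : t ∉ T10 M x) (htP : projH M x t = 0)
    {w : Cn N} (hw : L w = 0) (hwP : projH M x w = 0) : ∃ c : ℝ, w = c • t := by
  set H : Submodule ℝ (Cn N) := (T10 M x).restrictScalars ℝ
  have hHdim : Module.finrank ℝ H = 2 * (n - 1) := by
    rw [← hM.2.2 x hx]
    exact finrank_real_of_complex (T10 M x)
  set S : Submodule ℝ (Cn N) := H ⊔ Submodule.span ℝ {t}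
  have htS : t ∈ S := Submodule.mem_sup_right (Submodule.mem_span_singleton_self t)
  have hlt : H < S := lt_of_le_of_ne le_sup_left fun h => htH (by
    have : t ∈ H := h ▸ htS
    exact this)
  have hS := Submodule.finrank_lt_finrank_of_lt hlt
  have hle : S ≤ LinearMap.ker (L : Cn N →ₗ[ℝ] EuclideanSpace ℝ (Fin k)) := by
    refine sup_le (fun v hv => htan v (mem_tangentSp_of_mem_T10 hv)) ?_
    rw [Submodule.span_singleton_le_iff_mem]
    exact htan t ht
  -- `S` has dimension at least `2(n - 1) + 1`, which equals `2n - 1` because `n ≥ 1`.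
  have hSeq := Submodule.eq_of_le_of_finrank_le hle (by have := hM.1; omega)
  have hwS : w ∈ S := hSeq ▸ hw
  obtain ⟨h, hh, s, hs, rfl⟩ := Submodule.mem_sup.1 hwS
  obtain ⟨c, rfl⟩ := Submodule.mem_span_singleton.1 hs
  refine ⟨c, ?_⟩
  rw [map_add, map_smul, htP, smul_zero, add_zero, projH_eq_self hh] at hwP
  rw [hwP, zero_add]

/-! ### The transverse vector and its uniform bound -/

/-- A tangent vector orthogonal to the complex tangent space on which `γ` takes the value `i`. -/
theorem exists_normal_tangent {M : Set (Cn N)} {γ : Cn N → Cn N →L[ℝ] ℂ}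
    (hγ : IsCharacteristicForm M γ) {x : Cn N} (hx : x ∈ M) :
    ∃ t ∈ tangentSp M x, projH M x t = 0 ∧ γ x t = Complex.I := by
  obtain ⟨t, ht, h⟩ := hγ.normalized x hx
  have hPt := projH_mem M x t
  refine ⟨t - projH M x t, sub_mem ht hPt.1, ?_, ?_⟩
  · rw [map_sub, projH_eq_self hPt, sub_self]
  · rw [map_sub, hγ.annihilates x hx _ hPt, sub_zero]
    linear_combination -Complex.I * h + γ x t * Complex.I_sq

/-- If the lengths were unbounded, the normalized vectors would subconverge to a unit vector `e`
killed by `P`, by `γ` and by the differential of a defining map. The last makes `e` a multiple of a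
transverse vector when combined with `P e = 0`, and then `γ(e) = 0` forces `e = 0`. -/
theorem exists_bound_normal_tangent {M : Set (Cn N)} {n : ℕ} (hcpt : IsCompact M)
    (hM : IsCRHypersurfaceType M n) {γ : Cn N → Cn N →L[ℝ] ℂ} (hγ : IsCharacteristicForm M γ) :
    ∃ C : ℝ, ∀ x ∈ M, ∀ t ∈ tangentSp M x, projH M x t = 0 → γ x t = Complex.I → ‖t‖ ≤ C := by
  by_contra! hcon
  choose y hyM t ht htP htγ htn using fun m : ℕ => hcon (m : ℝ)
  have htpos : ∀ m, 0 < ‖t m‖ := fun m => (Nat.cast_nonneg m).trans_lt (htn m)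
  let s : ℕ → Cn N := fun m => (‖t m‖⁻¹ : ℝ) • t m
  have hs : ∀ m, (y m, s m) ∈ M ×ˢ Metric.sphere (0 : Cn N) 1 := by
    intro m
    refine ⟨hyM m, ?_⟩
    simp [s, norm_smul, (htpos m).ne']
  obtain ⟨⟨x, e⟩, ⟨hx, he⟩, φ, hφ, hlim⟩ :=
    (hcpt.prod (isCompact_sphere (0 : Cn N) 1)).tendsto_subseq hs
  have hy : Tendsto (fun m => y (φ m)) atTop (𝓝[M] x) :=
    tendsto_nhdsWithin_iff.2 ⟨(continuous_fst.tendsto _).comp hlim, Eventually.of_forall fun m => hyM _⟩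
  have hse : Tendsto (fun m => s (φ m)) atTop (𝓝 e) := (continuous_snd.tendsto _).comp hlim
  obtain ⟨k, U, ρ, hU, hxU, hρ, hloc⟩ := exists_local_defining hM hx
  have hlimit : ∀ {F : Type} [NormedAddCommGroup F] [NormedSpace ℝ F] {a : Cn N → Cn N →L[ℝ] F},
      ContinuousWithinAt a M x →
      Tendsto (fun m => a (y (φ m)) (s (φ m))) atTop (𝓝 (a x e)) :=
    fun {F} _ _ {a} ha => ((isBoundedBilinearMap_apply (𝕜 := ℝ) (E := Cn N) (F := F)).continuous.tendsto
      (a x, e)).comp ((ha.tendsto.comp hy).prodMk_nhds hse)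
  have hρe : fderiv ℝ ρ x e = 0 := by
    refine tendsto_nhds_unique (hlimit ((hρ.contDiffAt (hU.mem_nhds hxU)).fderiv_right (m := 0)
      (by norm_cast)).continuousAt.continuousWithinAt) ?_
    refine tendsto_const_nhds.congr' ?_
    filter_upwards [hy.eventually (mem_nhdsWithin_of_mem_nhds (hU.mem_nhds hxU))] with m hm
    exact ((hloc _ (hyM _) hm).1 _ (Submodule.smul_mem _ _ (ht _))).symm
  have hPe : projH M x e = 0 := by
    refine tendsto_nhds_unique (hlimit (differentiableWithinAt_projH hM hx).continuousWithinAt) ?_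
    refine tendsto_const_nhds.congr fun m => ?_
    simp only [s, map_smul, htP, smul_zero]
  have hγe : γ x e = 0 := by
    refine tendsto_nhds_unique (hlimit (hγ.smooth.continuousOn x hx)) ?_
    have hinf : Tendsto (fun m => ‖t m‖) atTop atTop :=
      tendsto_atTop_mono (fun m => (htn m).le) tendsto_natCast_atTop_atTop
    -- On the normalized vectors `γ` takes the value `i / ‖t m‖`.
    have h0 := ((tendsto_inv_atTop_zero.comp (hinf.comp hφ.tendsto_atTop))).smul_const Complex.I
    rw [zero_smul] at h0
    refine h0.congr fun m => ?_
    simp only [s, map_smul, htγ, Function.comp]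
  obtain ⟨t₀, ht₀, htP₀, htγ₀⟩ := exists_normal_tangent hγ hx
  obtain ⟨htan, hker, -⟩ := hloc x hx hxU
  obtain ⟨c, rfl⟩ := eq_smul_of_projH_eq_zero hM hx htan hker ht₀
    (fun h => Complex.I_ne_zero (htγ₀ ▸ hγ.annihilates x hx _ h)) htP₀ hρe hPe
  rw [map_smul, htγ₀, smul_eq_zero, or_iff_left Complex.I_ne_zero] at hγe
  simp [hγe] at he

/-! ### The complex Hessian as a sesquilinear form -/

theorem J_J (v : Cn N) : J N (J N v) = -v := by
  rw [J_apply, J_apply, smul_smul, Complex.I_mul_I, neg_one_smul]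

/-- Precomposition with the complex structure. -/
def compJ (N : ℕ) : (Cn N →L[ℝ] ℂ) →L[ℝ] (Cn N →L[ℝ] ℂ) :=
  (ContinuousLinearMap.compL ℝ (Cn N) (Cn N) ℂ).flip (J N)

theorem hasFDerivAt_delbar {f : Cn N → ℂ} {x : Cn N} (hf : DifferentiableAt ℝ (fderiv ℝ f) x) :
    HasFDerivAt (delbar f) (((1 / 2 : ℂ) • (ContinuousLinearMap.id ℝ (Cn N →L[ℝ] ℂ)
      + Complex.I • compJ N)) ∘L fderiv ℝ (fderiv ℝ f) x) x :=
  ((1 / 2 : ℂ) • (ContinuousLinearMap.id ℝ (Cn N →L[ℝ] ℂ)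
      + Complex.I • compJ N)).hasFDerivAt.comp x hf.hasFDerivAt

theorem hasFDerivAt_del {f : Cn N → ℂ} {x : Cn N} (hf : DifferentiableAt ℝ (fderiv ℝ f) x) :
    HasFDerivAt (del f) (((1 / 2 : ℂ) • (ContinuousLinearMap.id ℝ (Cn N →L[ℝ] ℂ)
      - Complex.I • compJ N)) ∘L fderiv ℝ (fderiv ℝ f) x) x :=
  ((1 / 2 : ℂ) • (ContinuousLinearMap.id ℝ (Cn N →L[ℝ] ℂ)
      - Complex.I • compJ N)).hasFDerivAt.comp x hf.hasFDerivAt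

theorem fderiv_delbar_apply {f : Cn N → ℂ} {x : Cn N} (hf : DifferentiableAt ℝ (fderiv ℝ f) x)
    (u v : Cn N) : fderiv ℝ (delbar f) x u v = (1 / 2 : ℂ) *
      (fderiv ℝ (fderiv ℝ f) x u v + Complex.I * fderiv ℝ (fderiv ℝ f) x u (J N v)) := by
  rw [(hasFDerivAt_delbar hf).fderiv]
  rfl

theorem fderiv_del_apply {f : Cn N → ℂ} {x : Cn N} (hf : DifferentiableAt ℝ (fderiv ℝ f) x)
    (u v : Cn N) : fderiv ℝ (del f) x u v = (1 / 2 : ℂ) *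
      (fderiv ℝ (fderiv ℝ f) x u v - Complex.I * fderiv ℝ (fderiv ℝ f) x u (J N v)) := by
  rw [(hasFDerivAt_del hf).fderiv]
  rfl

/-- `pair11` of a bilinear form is complex-linear in the first and conjugate-linear in the second
argument. -/
def pairSesq (B : Cn N →L[ℝ] Cn N →L[ℝ] ℂ) : Cn N →ₗ[ℂ] Cn N →ₗ⋆[ℂ] ℂ :=
  LinearMap.mk₂'ₛₗ _ _ (pair11 fun u v => B u v)
    (fun a b c => by
      simp only [pair11, map_add, add_apply]
      ring)
    (fun c a b => by
      have h : c • a = c.re • a + c.im • J N a := by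
        ext i
        simp only [J_apply, PiLp.smul_apply, PiLp.add_apply, smul_eq_mul, Complex.real_smul]
        conv_lhs => rw [← Complex.re_add_im c]
        ring
      rw [h]
      simp only [pair11, map_add, map_smul, J_J, map_neg, smul_neg, add_apply, smul_apply,
        neg_apply, Complex.real_smul, RingHom.id_apply, smul_eq_mul]
      conv_rhs => rw [← Complex.re_add_im c]
      linear_combination (-(1 / 4 : ℂ)) * (c.im : ℂ) * (B a (J N b)) * (Complex.I_sq)
        + (1 / 4 : ℂ) * (c.im : ℂ) * (B (J N a) b) * (Complex.I_sq))
    (fun a b c => by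
      simp only [pair11, map_add]
      ring)
    (fun c a b => by
      have h : c • b = c.re • b + c.im • J N b := by
        ext i
        simp only [J_apply, PiLp.smul_apply, PiLp.add_apply, smul_eq_mul, Complex.real_smul]
        conv_lhs => rw [← Complex.re_add_im c]
        ring
      have hc : (starRingEnd ℂ) c = c.re - c.im * Complex.I := by
        apply Complex.ext <;> simp
      rw [h]
      simp only [pair11, map_add, map_smul, J_J, map_neg, smul_neg, Complex.real_smul,
        smul_eq_mul]
      rw [hc]
      linear_combination ((1 / 4 : ℂ)) * (c.im : ℂ) * (B a (J N b)) * (Complex.I_sq)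
        - (1 / 4 : ℂ) * (c.im : ℂ) * (B (J N a) b) * (Complex.I_sq))

theorem pairSesq_apply (B : Cn N →L[ℝ] Cn N →L[ℝ] ℂ) (u v : Cn N) :
    pairSesq B u v = pair11 (fun u v => B u v) u v := rfl

theorem complexHessian_apply {f : Cn N → ℂ} {x : Cn N}
    (hf : DifferentiableAt ℝ (fderiv ℝ f) x) (j k : Fin N) :
    complexHessian f x j k = pairSesq (fderiv ℝ (fderiv ℝ f) x)
      (EuclideanSpace.single j 1) (EuclideanSpace.single k 1) := by
  set e : Fin N → Cn N := fun j => EuclideanSpace.single j 1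
  have h : HasFDerivAt (fun y => delbar f y (e k)) ((ContinuousLinearMap.apply ℝ ℂ (e k)) ∘L
      fderiv ℝ (delbar f) x) x :=
    (ContinuousLinearMap.apply ℝ ℂ (e k)).hasFDerivAt.comp x
      (hasFDerivAt_delbar hf).differentiableAt.hasFDerivAt
  have hv : ∀ u, fderiv ℝ (fun y => delbar f y (e k)) x u = fderiv ℝ (delbar f) x u (e k) := by
    intro u
    rw [h.fderiv]
    rfl
  have hdel : complexHessian f x j k = (1 / 2 : ℂ) * (fderiv ℝ (delbar f) x (e j) (e k)
      - Complex.I * fderiv ℝ (delbar f) x (J N (e j)) (e k)) := by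
    rw [← hv, ← hv]
    rfl
  rw [hdel, pairSesq_apply, pair11, fderiv_delbar_apply hf, fderiv_delbar_apply hf]
  linear_combination (-(1 / 4 : ℂ)) * fderiv ℝ (fderiv ℝ f) x (J N (e j)) (J N (e k)) * Complex.I_sq

/-- Entrywise complex conjugation. -/
def conjVec (v : Cn N) : Cn N := WithLp.toLp 2 fun i => (starRingEnd ℂ) (v i)

theorem orthonormal_conjVec {ι : Type*} {Z : ι → Cn N} (hZ : Orthonormal ℂ Z) :
    Orthonormal ℂ fun j => conjVec (Z j) := by
  classical
  rw [orthonormal_iff_ite] at hZ ⊢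
  intro i j
  have h : inner ℂ (conjVec (Z i)) (conjVec (Z j)) = (starRingEnd ℂ) (inner ℂ (Z i) (Z j)) := by
    simp [PiLp.inner_apply, conjVec]
  rw [h, hZ i j]
  split_ifs <;> simp

/-- The pairing is `∑ ξ_j conj(ξ_k) H_jk`, with the conjugate on the column index. As a quadratic
form of `H` it is therefore evaluated at the conjugate vector, and conjugation preserves
orthonormality. -/
theorem pairSesq_self_eq_inner {f : Cn N → ℂ} {x : Cn N}
    (hf : DifferentiableAt ℝ (fderiv ℝ f) x) (ξ : Cn N) :
    pairSesq (fderiv ℝ (fderiv ℝ f) x) ξ ξ = inner ℂ (conjVec ξ)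
      (Matrix.toEuclideanLin (complexHessian f x) (conjVec ξ)) := by
  have hξ : ξ = ∑ j, ξ j • (EuclideanSpace.single j 1 : Cn N) := by
    conv_lhs => rw [← (EuclideanSpace.basisFun (Fin N) ℂ).sum_repr ξ]
    simp
  have hl : pairSesq (fderiv ℝ (fderiv ℝ f) x) ξ ξ
      = ∑ j, ∑ k, ξ j * ((starRingEnd ℂ) (ξ k) * complexHessian f x j k) := by
    conv_lhs => rw [hξ]
    simp only [map_sum, LinearMap.sum_apply, map_smulₛₗ, LinearMap.smul_apply, RingHom.id_apply,
      smul_eq_mul, ← complexHessian_apply hf]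
    rw [Finset.sum_comm]
    refine Finset.sum_congr rfl fun j _ => ?_
    rw [Finset.mul_sum]
    exact Finset.sum_congr rfl fun k _ => by ring
  rw [hl]
  simp only [PiLp.inner_apply, Matrix.toLpLin_apply, conjVec, Matrix.mulVec, dotProduct,
    RCLike.inner_apply, Complex.conj_conj, Finset.sum_mul]
  refine Finset.sum_congr rfl fun j _ => Finset.sum_congr rfl fun k _ => ?_
  ring

/-! ### Comparing the tangential form with the ambient Hessian -/

theorem extD_comp_projH {M : Set (Cn N)} {x : Cn N}
    (hP : DifferentiableWithinAt ℝ (projH M) M x) {α : Cn N → Cn N →L[ℝ] ℂ}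
    (hα : DifferentiableAt ℝ α x) {u v : Cn N} (hu : u ∈ T10 M x) (hv : v ∈ T10 M x) :
    extD M (fun y => α y ∘L projH M y) x u v = fderiv ℝ α x u v - fderiv ℝ α x v u
      + α x (fderivWithin ℝ (projH M) M x u v - fderivWithin ℝ (projH M) M x v u) := by
  have h : ∀ {a : Cn N}, a ∈ T10 M x → fderivWithin ℝ α M x a = fderiv ℝ α x a := fun ha =>
    eqOn_tangentSp_of_hasFDerivWithinAt
      hα.differentiableWithinAt.hasFDerivWithinAt hα.hasFDerivAt.hasFDerivWithinAt ha.1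
  rw [extD, fderivWithin_comp_projH hP hα.differentiableWithinAt hu.1 hv,
    fderivWithin_comp_projH hP hα.differentiableWithinAt hv.1 hu, h hu, h hv, map_sub]
  ring

/-- On the complex tangent space, half the difference of the exterior derivatives of `∂̄_b f` and
`∂_b f` is the ambient form minus a multiple of the Levi form. -/
theorem half_extD_sub_extD {M : Set (Cn N)} {n : ℕ} (hM : IsCRHypersurfaceType M n)
    {γ : Cn N → Cn N →L[ℝ] ℂ} (hγ : IsCharacteristicForm M γ) {x : Cn N} (hx : x ∈ M)
    {f : Cn N → ℂ} (hf : DifferentiableAt ℝ (fderiv ℝ f) x) {t : Cn N} (ht : t ∈ tangentSp M x)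
    (htP : projH M x t = 0) (htγ : γ x t = Complex.I) {u v : Cn N} (hu : u ∈ T10 M x)
    (hv : v ∈ T10 M x) :
    (1 / 2 : ℂ) * (extD M (delbarb M f) x u v - extD M (delb M f) x u v)
      = (Complex.I / 2) * (fderiv ℝ (fderiv ℝ f) x u (J N v) - fderiv ℝ (fderiv ℝ f) x v (J N u))
        - (1 / 2 : ℂ) * fderiv ℝ f x (J N t) * extD M γ x u v := by
  have hP := differentiableWithinAt_projH hM hx
  obtain ⟨k, U, ρ, hU, hxU, hρ, hloc⟩ := exists_local_defining hM hx
  obtain ⟨htan, hker, -⟩ := hloc x hx hxU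
  -- The bracket vector is tangent in the sense of `ρ` and orthogonal to `T10`, hence a multiple of
  -- `t`.
  obtain ⟨c, hc⟩ := eq_smul_of_projH_eq_zero hM hx htan hker ht
    (fun h => Complex.I_ne_zero (htγ ▸ hγ.annihilates x hx _ h)) htP
    (fderiv_defining_bracket hx hP hU hxU hρ (fun y hy hyU => (hloc y hy hyU).1) hu hv)
    (by rw [map_sub, projH_fderivWithin_projH hP hu.1 hv, projH_fderivWithin_projH hP hv.1 hu,
      sub_zero])
  have hγd : DifferentiableWithinAt ℝ γ M x := hγ.smooth.differentiableOn (by simp) x hx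
  have hγann : ∀ᶠ y in 𝓝[M] x, ∀ v ∈ T10 M y, γ y v = 0 := by
    filter_upwards [self_mem_nhdsWithin] with y hy using hγ.annihilates y hy
  have hlevi : extD M γ x u v = -(c * Complex.I) := by
    rw [extD, fderivWithin_apply_of_comp_projH_eq_zero hx hP hγd hγann hu.1 hv,
      fderivWithin_apply_of_comp_projH_eq_zero hx hP hγd hγann hv.1 hu, ← htγ,
      ← Complex.real_smul, ← map_smul, ← hc, map_sub]
    ring
  have h1 : extD M (delbarb M f) x u v = _ :=
    extD_comp_projH hP (hasFDerivAt_delbar hf).differentiableAt hu hv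
  have h2 : extD M (delb M f) x u v = _ :=
    extD_comp_projH hP (hasFDerivAt_del hf).differentiableAt hu hv
  have h3 : ∀ w, delbar f x w - del f x w = Complex.I * fderiv ℝ f x (J N w) := by
    intro w
    simp only [delbar, del, smul_apply, add_apply, sub_apply, smul_eq_mul,
      ContinuousLinearMap.comp_apply]
    ring
  have h4 := h3 (c • t)
  rw [map_smul (J N), map_smul (fderiv ℝ f x), Complex.real_smul] at h4
  rw [h1, h2, hlevi, hc, fderiv_delbar_apply hf, fderiv_delbar_apply hf, fderiv_del_apply hf,
    fderiv_del_apply hf]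
  linear_combination (1 / 2 : ℂ) * h4

/-- `½(∂_b ∂̄_b f - ∂̄_b ∂_b f)` is the complex Hessian minus a multiple of the Levi form. -/
theorem half_delbDelbarb_sub_delbarbDelb {M : Set (Cn N)} {n : ℕ}
    (hM : IsCRHypersurfaceType M n) {γ : Cn N → Cn N →L[ℝ] ℂ} (hγ : IsCharacteristicForm M γ)
    {x : Cn N} (hx : x ∈ M) {f : Cn N → ℂ} (hf : ContDiffAt ℝ ∞ f x) {t : Cn N}
    (ht : t ∈ tangentSp M x) (htP : projH M x t = 0) (htγ : γ x t = Complex.I) {ξ : Cn N}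
    (hξ : ξ ∈ T10 M x) :
    (1 / 2 : ℂ) * (delbDelbarb M f x ξ ξ - delbarbDelb M f x ξ ξ)
      = pairSesq (fderiv ℝ (fderiv ℝ f) x) ξ ξ
        - (1 / 2 : ℂ) * fderiv ℝ f x (J N t) * leviForm M γ x ξ ξ := by
  have hd : DifferentiableAt ℝ (fderiv ℝ f) x :=
    (hf.fderiv_right (m := 1) (by norm_cast)).differentiableAt (by simp)
  have hsymm : IsSymmSndFDerivAt ℝ f x := hf.isSymmSndFDerivAt (by simpa using ENat.LEInfty.out)
  have key := fun {u v : Cn N} => half_extD_sub_extD hM hγ hx hd ht htP htγ (u := u) (v := v)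
  have hJ := J_mem_T10 hξ
  have k1 := key hξ hξ
  have k2 := key hξ hJ
  have k3 := key hJ hξ
  have k4 := key hJ hJ
  simp only [J_J, map_neg] at k1 k2 k3 k4
  simp only [delbDelbarb, delbarbDelb, leviForm, pairSesq_apply, pair11]
  have hs := hsymm.eq ξ (J N ξ)
  -- The second-derivative parts of `k1` and `k4` vanish; `k2` and `k3` yield the diagonal terms of
  -- the Hessian. Its mixed terms cancel by symmetry (`hs`).
  linear_combination (1 / 4 : ℂ) * k1 + (Complex.I / 4) * k2 - (Complex.I / 4) * k3
    + (1 / 4 : ℂ) * k4 - (1 / 4 : ℂ) * (fderiv ℝ (fderiv ℝ f) x ξ ξ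
      + fderiv ℝ (fderiv ℝ f) x (J N ξ) (J N ξ)) * Complex.I_sq - (Complex.I / 4) * hs

/-! ### The constant and the conclusion -/

theorem exists_bound_half_fderiv_J {M U : Set (Cn N)} {n : ℕ} (hcpt : IsCompact M)
    (hM : IsCRHypersurfaceType M n) {γ : Cn N → Cn N →L[ℝ] ℂ} (hγ : IsCharacteristicForm M γ)
    {lam : Cn N → ℝ} (hU : IsOpen U) (hMU : M ⊆ U) (hlam : ContDiffOn ℝ ∞ lam U) :
    ∃ C : ℝ, 0 < C ∧ ∀ x ∈ M, ∀ t ∈ tangentSp M x, projH M x t = 0 → γ x t = Complex.I →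
      (1 / 2 : ℝ) * fderiv ℝ lam x (J N t) ≤ C := by
  obtain ⟨C₁, hC₁⟩ := exists_bound_normal_tangent hcpt hM hγ
  obtain ⟨C₂, hC₂⟩ := hcpt.exists_bound_of_continuousOn
    ((hlam.continuousOn_fderiv_of_isOpen hU (by simp)).mono hMU)
  -- The summand `1` only makes the constant strictly positive.
  refine ⟨|C₂| * |C₁| + 1, by positivity, fun x hx t ht htP htγ => ?_⟩
  have h1 : ‖fderiv ℝ lam x (J N t)‖ ≤ ‖fderiv ℝ lam x‖ * ‖J N t‖ :=
    ContinuousLinearMap.le_opNorm _ _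
  have h2 : ‖J N t‖ = ‖t‖ := by rw [J_apply, norm_smul, Complex.norm_I, one_mul]
  have h3 : ‖fderiv ℝ lam x‖ * ‖J N t‖ ≤ |C₂| * |C₁| := by
    rw [h2]
    exact mul_le_mul ((hC₂ x hx).trans (le_abs_self _))
      ((hC₁ x hx t ht htP htγ).trans (le_abs_self _)) (norm_nonneg _) (abs_nonneg _)
  have h4 := le_abs_self (fderiv ℝ lam x (J N t))
  rw [Real.norm_eq_abs] at h1
  have h5 := abs_nonneg (fderiv ℝ lam x (J N t))
  linarith

theorem crPshBound_of_isPshOnForms {n q : ℕ} {M : Set (Cn N)} (hcpt : IsCompact M)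
    (hM : IsCRHypersurfaceType M n) {γ : Cn N → Cn N →L[ℝ] ℂ} (hγ : IsCharacteristicForm M γ)
    (hpsc : LeviNonneg M γ) {lam : Cn N → ℝ} {A : ℝ} {U : Set (Cn N)} (hU : IsOpen U)
    (hMU : M ⊆ U) (hlam : IsPshOnForms q lam U A) : CRPshBound M γ q lam A := by
  obtain ⟨hsm, -, heig⟩ := hlam
  obtain ⟨C, hC, hbound⟩ := exists_bound_half_fderiv_J hcpt hM hγ hU hMU hsm
  refine ⟨C, hC, fun x hx Z hZ hZo => ?_⟩
  obtain ⟨t, ht, htP, htγ⟩ := exists_normal_tangent hγ hx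
  have hlamx : ContDiffAt ℝ ∞ lam x := hsm.contDiffAt (hU.mem_nhds (hMU hx))
  have hf : ContDiffAt ℝ ∞ (fun y => (lam y : ℂ)) x :=
    Complex.ofRealCLM.contDiff.contDiffAt.comp x hlamx
  have hd : DifferentiableAt ℝ (fderiv ℝ fun y => (lam y : ℂ)) x :=
    (hf.fderiv_right (m := 1) (by norm_cast)).differentiableAt (by simp)
  have hfd : ∀ v, fderiv ℝ (fun y => (lam y : ℂ)) x v = (fderiv ℝ lam x v : ℂ) := by
    intro v
    have h : HasFDerivAt (fun y => (lam y : ℂ)) (Complex.ofRealCLM ∘L fderiv ℝ lam x) x :=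
      Complex.ofRealCLM.hasFDerivAt.comp x (hlamx.differentiableAt (by simp)).hasFDerivAt
    rw [h.fderiv]
    rfl
  obtain ⟨hH, hsum⟩ := heig x (hMU hx)
  refine (le_sum_re_inner_of_le_sum_eigenvalues hH hsum _ (orthonormal_conjVec hZo)).trans ?_
  rw [Complex.re_sum]
  refine Finset.sum_le_sum fun j _ => ?_
  rw [half_delbDelbarb_sub_delbarbDelb hM hγ hx hf ht htP htγ (hZ j), pairSesq_self_eq_inner hd,
    hfd]
  have hcast : ((1 / 2 : ℂ) * (fderiv ℝ lam x (J N t) : ℂ))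
      = (((1 / 2 : ℝ) * fderiv ℝ lam x (J N t) : ℝ) : ℂ) := by push_cast; rfl
  rw [hcast, Complex.add_re, Complex.sub_re, Complex.re_ofReal_mul, Complex.re_ofReal_mul]
  -- Weak pseudoconvexity enters here: `C - ½ dλ(Jt) ≥ 0` is multiplied by a nonnegative Levi form.
  have := mul_le_mul_of_nonneg_right (hbound x hx t ht htP htγ) (hpsc x hx _ (hZ j))
  linarith

end CRGeom
end

theorem mainTheorem5 {N : ℕ} (n q : ℕ) (M : Set (CRGeom.Cn N)) (hcpt : IsCompact M)
    (hM : CRGeom.IsCRHypersurfaceType M n)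
    (γ : CRGeom.Cn N → CRGeom.Cn N →L[ℝ] ℂ) (hγ : CRGeom.IsCharacteristicForm M γ)
    (hpsc : CRGeom.LeviNonneg M γ)
    (lam : CRGeom.Cn N → ℝ) (A : ℝ) (U : Set (CRGeom.Cn N)) (hU : IsOpen U) (hMU : M ⊆ U)
    (hlam : CRGeom.IsPshOnForms q lam U A) :
    CRGeom.IsWeaklyCRPsh M γ q lam A ∧ (0 < A → CRGeom.IsStrictlyCRPsh M γ q lam A) := by
  have hnear : CRGeom.SmoothNear M lam := ⟨U, hU, hMU, hlam.1⟩
  have hbound := CRGeom.crPshBound_of_isPshOnForms hcpt hM hγ hpsc hU hMU hlam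
  exact ⟨⟨hnear, hlam.2.1, hbound⟩, fun hA => ⟨hnear, hA, hbound⟩⟩
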